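/- Let $n\ge 2$, $0<\alpha<2$, and let $f,g$ be probability densities on $\mathbb R^n$. Write $\widehat f(\xi)=\int_{\mathbb R^n}e^{-i\xi\cdot x}f(x)\,dx$ and $$c_{n,\alpha}=\frac{\alpha 2^{\alpha}\,\Gamma\left(\frac{n+\alpha}{2}\right)}{2\pi^{n/2}\,\Gamma\left(\frac{2-\alpha}{2}\right)},\qquad d_{n,\alpha}=\frac{2^{\alpha}}{2^{2}\pi^{n/2}}\,\frac{\Gamma\left(\frac{n-2+\alpha}{2}\right)}{\Gamma\left(\frac{2-\alpha}{2}\right)},$$ $$A_{n,\alpha}=c_{n,\alpha}\frac{2\pi^{n/2}}{\Gamma(n/2)},\qquad B_{n,\alpha}=\frac{c_{n,\alpha}}{d_{n,\alpha}},\qquad D_{n,\alpha}=A_{n,\alpha}^{\frac{2}{4-\alpha}}B_{n,\alpha}^{\frac{2-\alpha}{4-\alpha}}\left[\frac{2^{\frac{2-\alpha}{4-\alpha}}}{2-\alpha}+\left(\tfrac12\right)^{\frac{2}{4-\alpha}}\right].$$ Define, with values in $[0,\infty]$, $$d_1(f,g)=\sup_{\xi\ne 0}\frac{|\widehat f(\xi)-\widehat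 g(\xi)|}{|\xi|},\quad E_\alpha(f,g)=c_{n,\alpha}\int_{\mathbb R^n}\frac{|\widehat f(\xi)-\widehat g(\xi)|^2}{|\xi|^{n+\alpha}}\,d\xi,\quad E_{-(2-\alpha)}(f,g)=d_{n,\alpha}\int_{\mathbb R^n}\frac{|\widehat f(\xi)-\widehat g(\xi)|^2}{|\xi|^{n-2+\alpha}}\,d\xi .$$ Then, in $[0,\infty]$ (with $0\cdot\infty=0$), $$E_\alpha(f,g)\le D_{n,\alpha}\,d_1(f,g)^{\frac{4}{4-\alpha}}\,E_{-(2-\alpha)}(f,g)^{\frac{2-\alpha}{4-\alpha}}.$$ Moreover $$E_\alpha(f,g)=-\iint_{\mathbb R^n\times\mathbb R^n}|x-y|^{\alpha}[f(x)-g(x)][f(y)-g(y)]\,dx\,dy,$$ $$E_{-(2-\alpha)}(f,g)=\iint_{\mathbb R^n\times\mathbb R^n}\frac{[f(x)-g(x)][f(y)-g(y)]}{|x-y|^{2-\alpha}}\,dx\,dy,$$ each whenever the corresponding double integral converges absolutely (so that this double-integral expression is then nonnegative); in particular, when both converge absolutely, the same inequality holds with $E_\alpha$ and $E_{-(2-\alpha)}$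 given by these double integrals. -/

import Mathlib

open MeasureTheory
open scoped ENNReal

noncomputable section

namespace EnergyDistance

/-- `f` is a probability density on `ℝⁿ` with respect to Lebesgue measure. -/
structure IsProbDensity {n : ℕ} (f : EuclideanSpace ℝ (Fin n) → ℝ) : Prop where
  nonneg : ∀ᵐ x ∂volume, 0 ≤ f x
  integrable : Integrable f volume
  integral_eq_one : ∫ x, f x = 1

/-- The Fourier transform `f̂(ξ) = ∫ e^{-i ξ·x} f(x) dx` (no factor `2π`). -/
def fourier {n : ℕ} (f : EuclideanSpace ℝ (Fin n) → ℝ) (ξ : EuclideanSpace ℝ (Fin n)) : ℂ :=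
  ∫ x, Complex.exp (-Complex.I * ((inner ℝ ξ x : ℝ) : ℂ)) * ((f x : ℝ) : ℂ)

/-- `c_{n,α}` -/
def cConst (n : ℕ) (α : ℝ) : ℝ :=
  (α * 2 ^ α * Real.Gamma (((n : ℝ) + α) / 2)) /
    (2 * Real.pi ^ ((n : ℝ) / 2) * Real.Gamma ((2 - α) / 2))

/-- `d_{n,α}` -/
def dConst (n : ℕ) (α : ℝ) : ℝ :=
  (2 ^ α / (2 ^ 2 * Real.pi ^ ((n : ℝ) / 2))) *
    (Real.Gamma (((n : ℝ) - 2 + α) / 2) / Real.Gamma ((2 - α) / 2))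

/-- `A_{n,α}` -/
def AConst (n : ℕ) (α : ℝ) : ℝ :=
  cConst n α * (2 * Real.pi ^ ((n : ℝ) / 2) / Real.Gamma ((n : ℝ) / 2))

/-- `B_{n,α}` -/
def BConst (n : ℕ) (α : ℝ) : ℝ := cConst n α / dConst n α

/-- `D_{n,α}` -/
def DConst (n : ℕ) (α : ℝ) : ℝ :=
  AConst n α ^ (2 / (4 - α)) * BConst n α ^ ((2 - α) / (4 - α)) *
    (2 ^ ((2 - α) / (4 - α)) / (2 - α) + (1 / 2) ^ (2 / (4 - α)))

/-- The Fourier-based metric `d₁(f,g) = sup_{ξ ≠ 0} |f̂(ξ) - ĝ(ξ)| / |ξ|`, with values in `[0,∞]`. -/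
def dOne {n : ℕ} (f g : EuclideanSpace ℝ (Fin n) → ℝ) : ℝ≥0∞ :=
  ⨆ (ξ : EuclideanSpace ℝ (Fin n)) (_ : ξ ≠ 0),
    ENNReal.ofReal (‖fourier f ξ - fourier g ξ‖ / ‖ξ‖)

/-- The Energy distance of order `α` in Fourier form, with values in `[0,∞]`. -/
def energyFourier {n : ℕ} (α : ℝ) (f g : EuclideanSpace ℝ (Fin n) → ℝ) : ℝ≥0∞ :=
  ENNReal.ofReal (cConst n α) *
    ∫⁻ ξ : EuclideanSpace ℝ (Fin n),
      ENNReal.ofReal (‖fourier f ξ - fourier g ξ‖ ^ 2 / ‖ξ‖ ^ ((n : ℝ) + α))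

/-- The Energy distance of negative order `-(2-α)` in Fourier form, with values in `[0,∞]`. -/
def negEnergyFourier {n : ℕ} (α : ℝ) (f g : EuclideanSpace ℝ (Fin n) → ℝ) : ℝ≥0∞ :=
  ENNReal.ofReal (dConst n α) *
    ∫⁻ ξ : EuclideanSpace ℝ (Fin n),
      ENNReal.ofReal (‖fourier f ξ - fourier g ξ‖ ^ 2 / ‖ξ‖ ^ ((n : ℝ) - 2 + α))

/-- The integrand `|x-y|^β [f(x)-g(x)] [f(y)-g(y)]`. -/
def kernel {n : ℕ} (β : ℝ) (f g : EuclideanSpace ℝ (Fin n) → ℝ)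
    (p : EuclideanSpace ℝ (Fin n) × EuclideanSpace ℝ (Fin n)) : ℝ :=
  ‖p.1 - p.2‖ ^ β * ((f p.1 - g p.1) * (f p.2 - g p.2))

/-- The double integral of `|x-y|^β [f(x)-g(x)] [f(y)-g(y)]` converges absolutely. -/
def Converges {n : ℕ} (β : ℝ) (f g : EuclideanSpace ℝ (Fin n) → ℝ) : Prop :=
  Integrable (kernel β f g) (volume.prod volume)

/-- The Energy distance of order `α`, as a double integral:
`E_α(f,g) = -∬ |x-y|^α [f(x)-g(x)] [f(y)-g(y)] dx dy`. -/
def energy {n : ℕ} (α : ℝ) (f g : EuclideanSpace ℝ (Fin n) → ℝ) : ℝ :=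
  -∫ p, kernel α f g p ∂(volume.prod volume)

/-- The Energy distance of negative order `-(2-α)`, as a double integral:
`E_{-(2-α)}(f,g) = ∬ |x-y|^{-(2-α)} [f(x)-g(x)] [f(y)-g(y)] dx dy`. -/
def negEnergy {n : ℕ} (α : ℝ) (f g : EuclideanSpace ℝ (Fin n) → ℝ) : ℝ :=
  ∫ p, kernel (-(2 - α)) f g p ∂(volume.prod volume)

end EnergyDistance

end

/-!
Write `h = f - g`, an integrable function of integral zero.

**Inequality.** On `‖ξ‖ < R` the bound `‖ĥ ξ‖ ≤ d₁ ‖ξ‖` reduces the energy of order `α` to the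
integral of `‖ξ‖ ^ (2 - α - n)` over a ball, and on `‖ξ‖ ≥ R` the two Fourier weights differ by a
factor at most `R ^ (-2)` (`energyFourier_le_add`). The constant `D` is the value of the resulting
bound at the best radius (`value_at_optimal_radius`). Degenerate values `0` and `∞` of `d₁` and of
the energy of negative order are treated directly (`energyFourier_le`).

**Double integrals.** Both power kernels are mixtures of Gaussians over a scale `t > 0`: the power
`r ^ (-(2 - α))` is a multiple of `∫ t ^ ((2 - α) / 2 - 1) * exp (-(r ^ 2 * t)) dt`, and `r ^ α` is a
multiple of `∫ t ^ (-α / 2 - 1) * (1 - exp (-(r ^ 2 * t))) dt`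
(`lintegral_rpow_mul_one_sub_exp_neg_mul`), where the constant `1` drops out because `h` has
integral zero. The mixing kernels are nonnegative, so absolute convergence of the double integral is
exactly what Fubini's theorem needs to bring the `t`-integral outside
(`integral_energy_of_mixture`). For each `t` the Gaussian energy of `h` is a Gaussian average of
`‖ĥ‖ ^ 2` (`integral_exp_mul_norm_fourier_sq`); in particular it is nonnegative, so Tonelli's theorem
allows the `t`-integral to be computed first, and it gives the power weight in `ξ`
(`energy_eq_lintegral_fourier`).
-/

namespace EnergyDistance

open Set Real

variable {n : ℕ} {h : EuclideanSpace ℝ (Fin n) → ℝ}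

/-! ### Gamma integrals and subordination of powers -/

theorem integrableOn_rpow_mul_exp_neg_mul {a r : ℝ} (ha : 0 < a) (hr : 0 < r) :
    IntegrableOn (fun t : ℝ => t ^ (a - 1) * exp (-(r * t))) (Ioi 0) := by
  have := integrableOn_rpow_mul_exp_neg_mul_rpow (p := 1) (s := a - 1) (b := r)
    (by linarith) one_pos hr
  simpa only [rpow_one, neg_mul] using this

theorem lintegral_rpow_mul_exp_neg_mul {a r : ℝ} (ha : 0 < a) (hr : 0 < r) :
    ∫⁻ t in Ioi (0 : ℝ), ENNReal.ofReal (t ^ (a - 1) * exp (-(r * t))) =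
      ENNReal.ofReal (Gamma a * r ^ (-a)) := by
  have hint := integrableOn_rpow_mul_exp_neg_mul ha hr
  rw [← ofReal_integral_eq_lintegral_ofReal hint, integral_rpow_mul_exp_neg_mul_Ioi ha hr,
    one_div, inv_rpow hr.le, rpow_neg hr.le, mul_comm]
  filter_upwards [ae_restrict_mem measurableSet_Ioi] with t ht
  exact mul_nonneg (rpow_nonneg (le_of_lt ht) _) (exp_pos _).le

theorem lintegral_rpow_mul_exp_neg_div {a r : ℝ} (ha : 0 < a) (hr : 0 < r) :
    ∫⁻ t in Ioi (0 : ℝ), ENNReal.ofReal (t ^ (-a - 1) * exp (-(r / t))) =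
      ENNReal.ofReal (Gamma a * r ^ (-a)) := by
  -- the substitution `t ↦ t⁻¹` turns this into the Gamma integral
  have hcomp : ∀ t ∈ Ioi (0 : ℝ),
      (|(-1 : ℝ)| * t ^ ((-1 : ℝ) - 1)) • ((t ^ (-1 : ℝ)) ^ (a - 1) * exp (-(r * t ^ (-1 : ℝ)))) =
        t ^ (-a - 1) * exp (-(r / t)) := by
    intro t ht
    have ht : 0 < t := ht
    rw [← rpow_mul ht.le, smul_eq_mul, ← mul_assoc, abs_neg, abs_one, one_mul, ← rpow_add ht,
      rpow_neg_one, div_eq_mul_inv]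
    ring_nf
  have hint := integrableOn_rpow_mul_exp_neg_mul ha hr
  have hint' : IntegrableOn (fun t : ℝ => t ^ (-a - 1) * exp (-(r / t))) (Ioi 0) := by
    rw [← integrableOn_Ioi_comp_rpow_iff _ (p := -1) (by norm_num)] at hint
    exact hint.congr_fun hcomp measurableSet_Ioi
  rw [← ofReal_integral_eq_lintegral_ofReal hint', ← setIntegral_congr_fun measurableSet_Ioi hcomp,
    integral_comp_rpow_Ioi (fun t => t ^ (a - 1) * exp (-(r * t))) (by norm_num : (-1 : ℝ) ≠ 0),
    integral_rpow_mul_exp_neg_mul_Ioi ha hr, one_div, inv_rpow hr.le, rpow_neg hr.le, mul_comm]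
  filter_upwards [ae_restrict_mem measurableSet_Ioi] with t ht
  exact mul_nonneg (rpow_nonneg (le_of_lt ht) _) (exp_pos _).le

/-- Subordination of a positive power: for `0 < b < 1` the power `a ^ b` is a mixture of the
functions `1 - exp (-(a * t))`. Integrate `t ^ (-b - 1) * a * exp (-(a * s))` over `0 < s < t`:
the inner integral over `s` gives the left side, the inner integral over `t` a Gamma integral. -/
theorem lintegral_rpow_mul_one_sub_exp_neg_mul {a b : ℝ} (ha : 0 ≤ a) (hb : 0 < b) (hb1 : b < 1) :
    ∫⁻ t in Ioi (0 : ℝ), ENNReal.ofReal (t ^ (-b - 1) * (1 - exp (-(a * t)))) =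
      ENNReal.ofReal (Gamma (1 - b) / b * a ^ b) := by
  rcases ha.eq_or_lt with rfl | ha
  · simp [zero_rpow hb.ne']
  set F : ℝ → ℝ → ℝ≥0∞ := fun t s =>
    {p : ℝ × ℝ | p.2 < p.1}.indicator
      (fun p => ENNReal.ofReal (p.1 ^ (-b - 1) * (a * exp (-(a * p.2))))) (t, s) with hF
  have hmeas : Measurable (Function.uncurry F) := by
    have : MeasurableSet {p : ℝ × ℝ | p.2 < p.1} := measurableSet_lt measurable_snd measurable_fst
    exact Measurable.indicator (by fun_prop) this
  have h1 : ∀ t ∈ Ioi (0 : ℝ), ENNReal.ofReal (t ^ (-b - 1) * (1 - exp (-(a * t)))) =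
      ∫⁻ s in Ioi (0 : ℝ), F t s := by
    intro t ht
    have ht : 0 < t := ht
    have e1 : ∀ s, F t s = (Iio t).indicator
        (fun s => ENNReal.ofReal (t ^ (-b - 1)) * ENNReal.ofReal (a * exp (-(a * s)))) s := by
      intro s
      by_cases hs : s < t
      · simp [hF, indicator, hs, ENNReal.ofReal_mul (rpow_nonneg ht.le (-b - 1))]
      · simp [hF, indicator, hs]
    have hcont : Continuous fun s : ℝ => a * exp (-(a * s)) := by fun_prop
    have e2 : ∫ s in (0 : ℝ)..t, a * exp (-(a * s)) = 1 - exp (-(a * t)) := by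
      rw [intervalIntegral.integral_eq_sub_of_hasDerivAt (f := fun s => -exp (-(a * s)))
        (fun s _ => ?_) (hcont.intervalIntegrable _ _)]
      · simp; ring
      · have h := (((hasDerivAt_id s).const_mul a).neg.exp).neg
        convert! h using 1
        simp
        ring
    simp_rw [e1]
    rw [lintegral_indicator measurableSet_Iio, Measure.restrict_restrict measurableSet_Iio,
      Iio_inter_Ioi, lintegral_const_mul _ (by fun_prop),
      ENNReal.ofReal_mul (rpow_nonneg ht.le _), ← e2,
      intervalIntegral.integral_of_le ht.le, integral_Ioc_eq_integral_Ioo,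
      ofReal_integral_eq_lintegral_ofReal]
    · exact (hcont.integrableOn_Icc).mono_set Ioo_subset_Icc_self
    · exact Filter.Eventually.of_forall fun s => by positivity
  have h2 : ∀ s ∈ Ioi (0 : ℝ), ∫⁻ t in Ioi (0 : ℝ), F t s =
      ENNReal.ofReal (a / b) * ENNReal.ofReal (s ^ ((1 - b) - 1) * exp (-(a * s))) := by
    intro s hs
    have hs : 0 < s := hs
    have e1 : ∀ t, F t s = (Ioi s).indicator
        (fun t => ENNReal.ofReal (a * exp (-(a * s))) * ENNReal.ofReal (t ^ (-b - 1))) t := by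
      intro t
      by_cases hst : s < t
      · simp [hF, indicator, hst, ← ENNReal.ofReal_mul (by positivity : 0 ≤ a * exp (-(a * s))),
          mul_comm]
      · simp [hF, indicator, hst]
    simp_rw [e1]
    rw [lintegral_indicator measurableSet_Ioi, Measure.restrict_restrict measurableSet_Ioi,
      Ioi_inter_Ioi, sup_of_le_left hs.le, lintegral_const_mul _ (by fun_prop),
      ← ofReal_integral_eq_lintegral_ofReal (integrableOn_Ioi_rpow_of_lt (by linarith) hs),
      integral_Ioi_rpow_of_lt (by linarith) hs, ← ENNReal.ofReal_mul (by positivity),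
      ← ENNReal.ofReal_mul (by positivity)]
    · congr 1
      rw [show -b - 1 + 1 = -b by ring, show 1 - b - 1 = -b by ring]
      field_simp
    · filter_upwards [ae_restrict_mem measurableSet_Ioi] with t ht
      exact rpow_nonneg (hs.trans ht).le _
  rw [setLIntegral_congr_fun measurableSet_Ioi h1, lintegral_lintegral_swap hmeas.aemeasurable,
    setLIntegral_congr_fun measurableSet_Ioi h2, lintegral_const_mul _ (by fun_prop),
    lintegral_rpow_mul_exp_neg_mul (by linarith) ha, ← ENNReal.ofReal_mul (by positivity)]
  congr 1
  rw [show -(1 - b) = b - 1 by ring, rpow_sub_one ha.ne']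
  field_simp

/-! ### The Fourier transform and Gaussian kernels -/

theorem norm_fourier_integrand (h : EuclideanSpace ℝ (Fin n) → ℝ)
    (ξ x : EuclideanSpace ℝ (Fin n)) :
    ‖Complex.exp (-Complex.I * ((inner ℝ ξ x : ℝ) : ℂ)) * ((h x : ℝ) : ℂ)‖ = ‖h x‖ := by
  rw [norm_mul, show -Complex.I * ((inner ℝ ξ x : ℝ) : ℂ) = ((-inner ℝ ξ x : ℝ) : ℂ) * Complex.I by
    push_cast; ring, Complex.norm_exp_ofReal_mul_I, one_mul, Complex.norm_real]

theorem integrable_fourier_integrand (hh : Integrable h) (ξ : EuclideanSpace ℝ (Fin n)) :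
    Integrable fun x =>
      Complex.exp (-Complex.I * ((inner ℝ ξ x : ℝ) : ℂ)) * ((h x : ℝ) : ℂ) :=
  hh.mono ((Continuous.aestronglyMeasurable (by fun_prop)).mul hh.ofReal.aestronglyMeasurable)
    (Filter.Eventually.of_forall fun x => (norm_fourier_integrand h ξ x).le)

theorem continuous_fourier (hh : Integrable h) : Continuous (fourier h) := by
  refine continuous_of_dominated (bound := fun x => ‖h x‖)
    (fun ξ => (integrable_fourier_integrand hh ξ).aestronglyMeasurable)
    (fun ξ => Filter.Eventually.of_forall fun x => (norm_fourier_integrand h ξ x).le) hh.norm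
    (Filter.Eventually.of_forall fun x => by fun_prop)

theorem norm_fourier_le (h : EuclideanSpace ℝ (Fin n) → ℝ) (ξ : EuclideanSpace ℝ (Fin n)) :
    ‖fourier h ξ‖ ≤ ∫ x, ‖h x‖ := by
  refine (norm_integral_le_integral_norm _).trans_eq ?_
  simp_rw [norm_fourier_integrand]

theorem fourier_sub {f g : EuclideanSpace ℝ (Fin n) → ℝ} (hf : Integrable f) (hg : Integrable g)
    (ξ : EuclideanSpace ℝ (Fin n)) :
    fourier f ξ - fourier g ξ = fourier (fun x => f x - g x) ξ := by
  rw [fourier, fourier, fourier, ← integral_sub (integrable_fourier_integrand hf ξ)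
    (integrable_fourier_integrand hg ξ)]
  simp_rw [← mul_sub, ← Complex.ofReal_sub]

theorem norm_fourier_sq_eq_integral (h : EuclideanSpace ℝ (Fin n) → ℝ)
    (ξ : EuclideanSpace ℝ (Fin n)) :
    ((‖fourier h ξ‖ ^ 2 : ℝ) : ℂ) =
      ∫ p : EuclideanSpace ℝ (Fin n) × EuclideanSpace ℝ (Fin n),
        Complex.exp (-Complex.I * ((inner ℝ (p.1 - p.2) ξ : ℝ) : ℂ)) * ((h p.1 * h p.2 : ℝ) : ℂ)
          ∂(volume.prod volume) := by
  rw [Complex.ofReal_pow, ← Complex.mul_conj', fourier, ← integral_conj, ← integral_prod_mul]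
  congr 1 with p
  simp only [map_mul, ← Complex.exp_conj, map_neg, Complex.conj_I, Complex.conj_ofReal,
    inner_sub_left, Complex.ofReal_sub, Complex.ofReal_mul]
  rw [mul_mul_mul_comm, ← Complex.exp_add, real_inner_comm ξ p.1, real_inner_comm ξ p.2]
  ring_nf

/-- Parseval's identity for a Gaussian kernel. It holds for every integrable `h`, since on the
Fourier side the Gaussian makes the triple integral absolutely convergent. -/
theorem integral_exp_mul_norm_fourier_sq (hh : Integrable h) {t : ℝ} (ht : 0 < t) :
    ∫ ξ, exp (-(‖ξ‖ ^ 2 / 4 / t)) * ‖fourier h ξ‖ ^ 2 =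
      (4 * π * t) ^ ((n : ℝ) / 2) *
        ∫ p : EuclideanSpace ℝ (Fin n) × EuclideanSpace ℝ (Fin n),
          exp (-(‖p.1 - p.2‖ ^ 2 * t)) * (h p.1 * h p.2) ∂(volume.prod volume) := by
  have hb : 0 < (((1 / (4 * t) : ℝ) : ℂ)).re := by
    rw [Complex.ofReal_re]; positivity
  set G : EuclideanSpace ℝ (Fin n) → EuclideanSpace ℝ (Fin n) → ℂ := fun z ξ =>
    Complex.exp (-((1 / (4 * t) : ℝ) : ℂ) * (‖ξ‖ : ℂ) ^ 2 + -Complex.I * ((inner ℝ z ξ : ℝ) : ℂ))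
    with hG
  have hGnorm : ∀ z ξ, ‖G z ξ‖ = exp (-(‖ξ‖ ^ 2 / 4 / t)) := by
    intro z ξ
    rw [hG, Complex.norm_exp]
    congr 1
    norm_cast
    simp [-Complex.ofReal_pow]
    field_simp
  have hGint : ∀ z, Integrable (G z) := fun z =>
    GaussianFourier.integrable_cexp_neg_mul_sq_norm_add hb (-Complex.I) z
  have hGval : ∀ z, ∫ ξ, G z ξ =
      (((4 * π * t) ^ ((n : ℝ) / 2) * exp (-(‖z‖ ^ 2 * t)) : ℝ) : ℂ) := by
    intro z
    refine (GaussianFourier.integral_cexp_neg_mul_sq_norm_add hb (-Complex.I) z).trans ?_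
    rw [Complex.ofReal_mul, Complex.ofReal_cpow (by positivity), Complex.ofReal_exp]
    congr 1
    · congr 1
      · push_cast; field_simp
      · simp
    · congr 1
      have : (t : ℂ) ≠ 0 := by exact_mod_cast ht.ne'
      push_cast
      rw [neg_sq, Complex.I_sq]
      field_simp
  -- the modulus of the triple integrand is a Gaussian in `ξ` times `|h x| * |h y|`
  have hI : Integrable (Function.uncurry fun (ξ : EuclideanSpace ℝ (Fin n))
      (p : EuclideanSpace ℝ (Fin n) × EuclideanSpace ℝ (Fin n)) =>
        G (p.1 - p.2) ξ * ((h p.1 * h p.2 : ℝ) : ℂ)) (volume.prod (volume.prod volume)) := by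
    have hmain := (hGint 0).mul_prod (Integrable.ofReal (𝕜 := ℂ) (hh.mul_prod hh))
    refine hmain.mono (AEStronglyMeasurable.mul (Continuous.aestronglyMeasurable ?_)
      (hh.mul_prod hh).ofReal.aestronglyMeasurable.comp_snd) ?_
    · simp only [hG]; fun_prop
    · refine Filter.Eventually.of_forall fun q => ?_
      simp only [Function.uncurry, norm_mul, hGnorm]
      exact le_rfl
  rw [← Complex.ofReal_inj, ← integral_complex_ofReal]
  calc ∫ ξ, ((exp (-(‖ξ‖ ^ 2 / 4 / t)) * ‖fourier h ξ‖ ^ 2 : ℝ) : ℂ)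
      = ∫ ξ, ∫ p : EuclideanSpace ℝ (Fin n) × EuclideanSpace ℝ (Fin n),
          G (p.1 - p.2) ξ * ((h p.1 * h p.2 : ℝ) : ℂ) ∂(volume.prod volume) := by
        congr 1 with ξ
        rw [Complex.ofReal_mul, norm_fourier_sq_eq_integral, ← integral_const_mul]
        congr 1 with p
        rw [← mul_assoc, Complex.ofReal_exp, ← Complex.exp_add]
        congr 3
        push_cast
        field_simp
    _ = ∫ p : EuclideanSpace ℝ (Fin n) × EuclideanSpace ℝ (Fin n),
          (((4 * π * t) ^ ((n : ℝ) / 2) *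
            (exp (-(‖p.1 - p.2‖ ^ 2 * t)) * (h p.1 * h p.2)) : ℝ) : ℂ) ∂(volume.prod volume) := by
        rw [integral_integral_swap hI]
        congr 1 with p
        rw [integral_mul_const, hGval, ← Complex.ofReal_mul, mul_assoc]
    _ = _ := by
        rw [integral_complex_ofReal, integral_const_mul]

/-! ### Double integrals in Fourier form -/

/-- The diagonal is a null set, so the junk value of `0 ^ β` for `β < 0` does not matter. -/
theorem ae_fst_sub_snd_ne_zero (hn : n ≠ 0) :
    ∀ᵐ p : EuclideanSpace ℝ (Fin n) × EuclideanSpace ℝ (Fin n) ∂(volume.prod volume),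
      p.1 - p.2 ≠ 0 := by
  have : NeZero n := ⟨hn⟩
  have := (Measure.ae_ne (volume : Measure (EuclideanSpace ℝ (Fin n))) 0)
  exact (quasiMeasurePreserving_sub volume volume).ae this

/-- Fubini's theorem for a power kernel written as a mixture `∫ κ t r dt = C * r ^ β` of
nonnegative kernels: absolute convergence of the energy with kernel `|x - y| ^ β` is all that is
needed to integrate the energies of the kernels `κ t` over `t`. -/
theorem integral_energy_of_mixture (hn : n ≠ 0) (hh : Integrable h) {β C : ℝ} (hC : 0 < C)
    {κ : ℝ → ℝ → ℝ} (hκm : Measurable (Function.uncurry κ))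
    (hκ0 : ∀ t, 0 < t → ∀ r, 0 ≤ κ t r)
    (hκ : ∀ r, 0 < r → ∫⁻ t in Ioi (0 : ℝ), ENNReal.ofReal (κ t r) = ENNReal.ofReal (C * r ^ β))
    (H : Integrable (fun p : EuclideanSpace ℝ (Fin n) × EuclideanSpace ℝ (Fin n) =>
      ‖p.1 - p.2‖ ^ β * (h p.1 * h p.2)) (volume.prod volume)) :
    IntegrableOn (fun t => ∫ p : EuclideanSpace ℝ (Fin n) × EuclideanSpace ℝ (Fin n),
        κ t ‖p.1 - p.2‖ * (h p.1 * h p.2) ∂(volume.prod volume)) (Ioi 0) ∧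
      ∫ t in Ioi (0 : ℝ), ∫ p : EuclideanSpace ℝ (Fin n) × EuclideanSpace ℝ (Fin n),
        κ t ‖p.1 - p.2‖ * (h p.1 * h p.2) ∂(volume.prod volume) =
      C * ∫ p : EuclideanSpace ℝ (Fin n) × EuclideanSpace ℝ (Fin n),
        ‖p.1 - p.2‖ ^ β * (h p.1 * h p.2) ∂(volume.prod volume) := by
  have hκr : ∀ r, Measurable fun t => κ t r := fun r => hκm.of_uncurry_right
  have hnn : ∀ r, 0 ≤ᵐ[volume.restrict (Ioi (0 : ℝ))] fun t => κ t r := fun r => by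
    filter_upwards [ae_restrict_mem measurableSet_Ioi] with t ht using hκ0 t ht r
  have hint : ∀ r, 0 < r → IntegrableOn (fun t => κ t r) (Ioi 0) := by
    intro r hr
    refine ⟨(hκr r).aestronglyMeasurable, ?_⟩
    rw [hasFiniteIntegral_iff_ofReal (hnn r), hκ r hr]
    exact ENNReal.ofReal_lt_top
  have hval : ∀ r, 0 < r → ∫ t in Ioi (0 : ℝ), κ t r = C * r ^ β := by
    intro r hr
    rw [integral_eq_lintegral_of_nonneg_ae (hnn r) (hκr r).aestronglyMeasurable, hκ r hr,
      ENNReal.toReal_ofReal (mul_nonneg hC.le (rpow_nonneg hr.le _))]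
  have hK : Integrable (Function.uncurry fun (t : ℝ)
      (p : EuclideanSpace ℝ (Fin n) × EuclideanSpace ℝ (Fin n)) =>
        κ t ‖p.1 - p.2‖ * (h p.1 * h p.2))
      ((volume.restrict (Ioi 0)).prod (volume.prod volume)) := by
    have hm : AEStronglyMeasurable (Function.uncurry fun (t : ℝ)
        (p : EuclideanSpace ℝ (Fin n) × EuclideanSpace ℝ (Fin n)) =>
          κ t ‖p.1 - p.2‖ * (h p.1 * h p.2))
        ((volume.restrict (Ioi 0)).prod (volume.prod volume)) := by
      refine AEStronglyMeasurable.mul (Measurable.aestronglyMeasurable ?_)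
        (hh.mul_prod hh).aestronglyMeasurable.comp_snd
      exact hκm.comp (f := fun q : ℝ × EuclideanSpace ℝ (Fin n) × EuclideanSpace ℝ (Fin n) =>
        (q.1, ‖q.2.1 - q.2.2‖)) (by fun_prop)
    rw [integrable_prod_iff' hm]
    constructor
    · filter_upwards [ae_fst_sub_snd_ne_zero hn] with p hp
      exact (hint _ (norm_pos_iff.2 hp)).mul_const (h p.1 * h p.2)
    · refine (H.norm.const_mul C).congr ?_
      filter_upwards [ae_fst_sub_snd_ne_zero hn] with p hp
      have hp := norm_pos_iff.2 hp
      have : ∀ t ∈ Ioi (0 : ℝ), ‖κ t ‖p.1 - p.2‖ * (h p.1 * h p.2)‖ =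
          κ t ‖p.1 - p.2‖ * ‖h p.1 * h p.2‖ := fun t ht => by
        rw [norm_mul, norm_of_nonneg (hκ0 t ht _)]
      simp only [Function.uncurry]
      rw [setIntegral_congr_fun measurableSet_Ioi this, integral_mul_const, hval _ hp,
        norm_mul (‖p.1 - p.2‖ ^ β), norm_of_nonneg (rpow_nonneg hp.le β), mul_assoc]
  refine ⟨hK.integral_prod_left, ?_⟩
  rw [integral_integral_swap hK, ← integral_const_mul]
  refine integral_congr_ae ?_
  filter_upwards [ae_fst_sub_snd_ne_zero hn] with p hp
  rw [integral_mul_const, hval _ (norm_pos_iff.2 hp), mul_assoc]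

theorem integrable_exp_mul_norm_fourier_sq (hh : Integrable h) {t : ℝ} (ht : 0 < t) :
    Integrable fun ξ => exp (-(‖ξ‖ ^ 2 / 4 / t)) * ‖fourier h ξ‖ ^ 2 := by
  have hG : Integrable fun ξ : EuclideanSpace ℝ (Fin n) => exp (-(‖ξ‖ ^ 2 / 4 / t)) := by
    have hb : 0 < (((1 / (4 * t) : ℝ) : ℂ)).re := by
      rw [Complex.ofReal_re]; positivity
    have := (GaussianFourier.integrable_cexp_neg_mul_sq_norm_add hb 0
      (0 : EuclideanSpace ℝ (Fin n))).norm
    refine this.congr (Filter.Eventually.of_forall fun ξ => ?_)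
    simp only [Complex.norm_exp]
    congr 1
    norm_cast
    simp [-Complex.ofReal_pow]
    field_simp
  refine (hG.mul_const ((∫ x, ‖h x‖) ^ 2)).mono' ?_ (Filter.Eventually.of_forall fun ξ => ?_)
  · have := continuous_fourier hh
    exact Continuous.aestronglyMeasurable (by fun_prop)
  · rw [norm_of_nonneg (by positivity)]
    gcongr
    exact norm_fourier_le h ξ

/-- Integrating the Gaussian averages of `‖ĥ‖ ^ 2` over the scale `t` produces a power weight. The
integrand is nonnegative, so the identity also holds when both sides are infinite. -/
theorem lintegral_rpow_mul_integral_exp_mul_norm_fourier_sq (hn : n ≠ 0) (hh : Integrable h)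
    {a : ℝ} (ha : 0 < a) :
    ∫⁻ t in Ioi (0 : ℝ), ENNReal.ofReal (t ^ (-a - 1) *
        ∫ ξ, exp (-(‖ξ‖ ^ 2 / 4 / t)) * ‖fourier h ξ‖ ^ 2) =
      ENNReal.ofReal (Gamma a * 4 ^ a) *
        ∫⁻ ξ, ENNReal.ofReal (‖fourier h ξ‖ ^ 2 / ‖ξ‖ ^ (2 * a)) := by
  have hc := (continuous_fourier hh).measurable
  have h1 : ∀ t ∈ Ioi (0 : ℝ), ENNReal.ofReal (t ^ (-a - 1) *
      ∫ ξ, exp (-(‖ξ‖ ^ 2 / 4 / t)) * ‖fourier h ξ‖ ^ 2) =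
      ∫⁻ ξ, ENNReal.ofReal (t ^ (-a - 1) * (exp (-(‖ξ‖ ^ 2 / 4 / t)) * ‖fourier h ξ‖ ^ 2)) := by
    intro t ht
    have ht : 0 < t := ht
    rw [← integral_const_mul, ofReal_integral_eq_lintegral_ofReal
      ((integrable_exp_mul_norm_fourier_sq hh ht).const_mul _)]
    exact Filter.Eventually.of_forall fun ξ => by positivity
  rw [setLIntegral_congr_fun measurableSet_Ioi h1, lintegral_lintegral_swap
    (Measurable.aemeasurable (by fun_prop)), ← lintegral_const_mul _ (by fun_prop)]
  have : NeZero n := ⟨hn⟩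
  refine lintegral_congr_ae ?_
  filter_upwards [Measure.ae_ne (volume : Measure (EuclideanSpace ℝ (Fin n))) 0] with ξ hξ
  have hξ : 0 < ‖ξ‖ := norm_pos_iff.2 hξ
  have h2 : ∀ t ∈ Ioi (0 : ℝ),
      ENNReal.ofReal (t ^ (-a - 1) * (exp (-(‖ξ‖ ^ 2 / 4 / t)) * ‖fourier h ξ‖ ^ 2)) =
      ENNReal.ofReal (t ^ (-a - 1) * exp (-(‖ξ‖ ^ 2 / 4 / t))) *
        ENNReal.ofReal (‖fourier h ξ‖ ^ 2) := by
    intro t ht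
    have ht : 0 < t := ht
    rw [← mul_assoc, ENNReal.ofReal_mul (by positivity)]
  rw [setLIntegral_congr_fun measurableSet_Ioi h2, lintegral_mul_const _ (by fun_prop),
    lintegral_rpow_mul_exp_neg_div ha (by positivity), ← ENNReal.ofReal_mul
      (mul_nonneg (Gamma_pos_of_pos ha).le (by positivity)), ← ENNReal.ofReal_mul
      (mul_nonneg (Gamma_pos_of_pos ha).le (by positivity))]
  congr 1
  rw [div_rpow (by positivity) (by norm_num), ← rpow_natCast, ← rpow_mul hξ.le,
    rpow_neg (by norm_num) a, Nat.cast_ofNat, mul_neg, rpow_neg hξ.le]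
  field_simp

/-- A power-law energy in Fourier form. The sign `ε` is that with which the mixing kernels `κ t`
act as a positive multiple of the Gaussian kernel `exp (-(r ^ 2 * t))`. -/
theorem energy_eq_lintegral_fourier (hn : n ≠ 0) (hh : Integrable h) {β C ε : ℝ} (hC : 0 < C)
    (hβ : 0 < (n : ℝ) + β) {κ : ℝ → ℝ → ℝ} (hκm : Measurable (Function.uncurry κ))
    (hκ0 : ∀ t, 0 < t → ∀ r, 0 ≤ κ t r)
    (hκ : ∀ r, 0 < r → ∫⁻ t in Ioi (0 : ℝ), ENNReal.ofReal (κ t r) = ENNReal.ofReal (C * r ^ β))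
    (hκG : ∀ t, 0 < t → ε * ∫ p : EuclideanSpace ℝ (Fin n) × EuclideanSpace ℝ (Fin n),
        κ t ‖p.1 - p.2‖ * (h p.1 * h p.2) ∂(volume.prod volume) =
      t ^ (-β / 2 - 1) * ∫ p : EuclideanSpace ℝ (Fin n) × EuclideanSpace ℝ (Fin n),
        exp (-(‖p.1 - p.2‖ ^ 2 * t)) * (h p.1 * h p.2) ∂(volume.prod volume))
    (H : Integrable (fun p : EuclideanSpace ℝ (Fin n) × EuclideanSpace ℝ (Fin n) =>
      ‖p.1 - p.2‖ ^ β * (h p.1 * h p.2)) (volume.prod volume)) :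
    0 ≤ ε * ∫ p : EuclideanSpace ℝ (Fin n) × EuclideanSpace ℝ (Fin n),
        ‖p.1 - p.2‖ ^ β * (h p.1 * h p.2) ∂(volume.prod volume) ∧
      ENNReal.ofReal (ε * ∫ p : EuclideanSpace ℝ (Fin n) × EuclideanSpace ℝ (Fin n),
        ‖p.1 - p.2‖ ^ β * (h p.1 * h p.2) ∂(volume.prod volume)) =
      ENNReal.ofReal (2 ^ β * Gamma ((n + β) / 2) / (π ^ ((n : ℝ) / 2) * C)) *
        ∫⁻ ξ, ENNReal.ofReal (‖fourier h ξ‖ ^ 2 / ‖ξ‖ ^ ((n : ℝ) + β)) := by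
  obtain ⟨hint, hval⟩ := integral_energy_of_mixture hn hh hC hκm hκ0 hκ H
  set I := ∫ p : EuclideanSpace ℝ (Fin n) × EuclideanSpace ℝ (Fin n),
    ‖p.1 - p.2‖ ^ β * (h p.1 * h p.2) ∂(volume.prod volume) with hI
  set φ : ℝ → ℝ := fun t => ∫ p : EuclideanSpace ℝ (Fin n) × EuclideanSpace ℝ (Fin n),
    κ t ‖p.1 - p.2‖ * (h p.1 * h p.2) ∂(volume.prod volume) with hφ
  set K : ℝ := C⁻¹ * (4 * π) ^ (-((n : ℝ) / 2)) with hKdef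
  have hK : 0 ≤ K := by positivity
  have hφG : ∀ t ∈ Ioi (0 : ℝ), C⁻¹ * (ε * φ t) = K * (t ^ (-((n + β) / 2) - 1) *
      ∫ ξ, exp (-(‖ξ‖ ^ 2 / 4 / t)) * ‖fourier h ξ‖ ^ 2) := by
    intro t ht
    have ht : 0 < t := ht
    rw [hφ, hκG t ht, integral_exp_mul_norm_fourier_sq hh ht, hKdef,
      mul_rpow (by positivity) ht.le, rpow_neg (by positivity),
      show -β / 2 - 1 = (-((n + β) / 2) - 1) + (n : ℝ) / 2 by ring, rpow_add ht]
    generalize ∫ p : EuclideanSpace ℝ (Fin n) × EuclideanSpace ℝ (Fin n),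
      exp (-(‖p.1 - p.2‖ ^ 2 * t)) * (h p.1 * h p.2) ∂(volume.prod volume) = J
    field_simp
  have hεI : ε * I = ∫ t in Ioi (0 : ℝ), C⁻¹ * (ε * φ t) := by
    rw [integral_const_mul, integral_const_mul, hval]
    field_simp
  have hnn : 0 ≤ᵐ[volume.restrict (Ioi (0 : ℝ))] fun t => C⁻¹ * (ε * φ t) := by
    filter_upwards [ae_restrict_mem measurableSet_Ioi] with t ht
    have ht' : 0 < t := ht
    rw [hφG t ht]
    exact mul_nonneg hK (mul_nonneg (by positivity) (integral_nonneg fun ξ => by positivity))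
  refine ⟨hεI ▸ integral_nonneg_of_ae hnn, ?_⟩
  rw [hεI, ofReal_integral_eq_lintegral_ofReal ((hint.const_mul ε).const_mul C⁻¹) hnn]
  have h3 : ∀ t ∈ Ioi (0 : ℝ), ENNReal.ofReal (C⁻¹ * (ε * φ t)) = ENNReal.ofReal K *
      ENNReal.ofReal (t ^ (-((n + β) / 2) - 1) *
        ∫ ξ, exp (-(‖ξ‖ ^ 2 / 4 / t)) * ‖fourier h ξ‖ ^ 2) := by
    intro t ht
    rw [hφG t ht, ENNReal.ofReal_mul hK]
  rw [setLIntegral_congr_fun measurableSet_Ioi h3, lintegral_const_mul' _ _ ENNReal.ofReal_ne_top,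
    lintegral_rpow_mul_integral_exp_mul_norm_fourier_sq hn hh (by positivity), ← mul_assoc,
    ← ENNReal.ofReal_mul hK, mul_div_cancel₀ _ (two_ne_zero)]
  congr 2
  rw [hKdef, mul_rpow (by norm_num) pi_pos.le, rpow_neg pi_pos.le, rpow_neg (by norm_num),
    show (4 : ℝ) ^ ((n + β) / 2) = 4 ^ ((n : ℝ) / 2) * 2 ^ β by
      rw [add_div, rpow_add (by norm_num)]
      congr 1
      rw [show (4 : ℝ) = 2 ^ (2 : ℝ) by norm_num, ← rpow_mul (by norm_num)]
      congr 1
      ring]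
  field_simp

theorem negEnergy_eq_negEnergyFourier (hn : 2 ≤ n) {α : ℝ} (hα0 : 0 < α) (hα2 : α < 2)
    {f g : EuclideanSpace ℝ (Fin n) → ℝ} (hf : Integrable f) (hg : Integrable g)
    (H : Converges (-(2 - α)) f g) :
    0 ≤ negEnergy α f g ∧ ENNReal.ofReal (negEnergy α f g) = negEnergyFourier α f g := by
  have hn' : (2 : ℝ) ≤ n := by exact_mod_cast hn
  have hG : 0 < Gamma ((2 - α) / 2) := Gamma_pos_of_pos (by linarith)
  have key := energy_eq_lintegral_fourier (n := n) (by omega) (hf.sub hg) (β := -(2 - α))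
    (C := Gamma ((2 - α) / 2)) (ε := 1) hG (by linarith)
    (κ := fun t r => t ^ ((2 - α) / 2 - 1) * exp (-(r ^ 2 * t))) (by fun_prop)
    (fun t ht r => by positivity) ?_ ?_ H
  · simp only [one_mul] at key
    refine ⟨key.1, ?_⟩
    rw [negEnergy]
    refine key.2.trans ?_
    rw [negEnergyFourier, show (n : ℝ) + -(2 - α) = n - 2 + α by ring]
    congr 1
    · congr 1
      rw [dConst, show -(2 - α) = α - 2 by ring, rpow_sub two_pos, rpow_two]
      field_simp
    · congr 1 with ξ
      rw [fourier_sub hf hg]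
      rfl
  · intro r hr
    rw [lintegral_rpow_mul_exp_neg_mul (by linarith) (by positivity)]
    congr 2
    rw [← rpow_natCast, ← rpow_mul hr.le]
    congr 1
    push_cast
    ring
  · intro t ht
    simp only [mul_assoc, one_mul]
    rw [integral_const_mul]
    congr 2
    ring

/-- For densities of equal mass the constant `1` in the mixing kernels `1 - exp (-(r ^ 2 * t))`
contributes nothing, so that only the Gaussian kernels remain. -/
theorem energy_eq_energyFourier (hn : n ≠ 0) {α : ℝ} (hα0 : 0 < α) (hα2 : α < 2)
    {f g : EuclideanSpace ℝ (Fin n) → ℝ} (hf : Integrable f) (hg : Integrable g)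
    (hfg : ∫ x, f x = ∫ x, g x) (H : Converges α f g) :
    0 ≤ energy α f g ∧ ENNReal.ofReal (energy α f g) = energyFourier α f g := by
  have hG : 0 < Gamma ((2 - α) / 2) := Gamma_pos_of_pos (by linarith)
  have hfg' := hf.sub hg
  have key := energy_eq_lintegral_fourier (n := n) hn hfg' (β := α)
    (C := Gamma ((2 - α) / 2) / (α / 2)) (ε := -1) (by positivity) (by positivity)
    (κ := fun t r => t ^ (-(α / 2) - 1) * (1 - exp (-(r ^ 2 * t)))) (by fun_prop)
    (fun t ht r => mul_nonneg (by positivity)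
      (sub_nonneg.2 (exp_le_one_iff.2 (neg_nonpos.2 (by positivity))))) ?_ ?_ H
  · simp only [neg_one_mul] at key
    refine ⟨key.1, ?_⟩
    rw [energy]
    refine key.2.trans ?_
    rw [energyFourier]
    congr 1
    · congr 1
      rw [cConst]
      field_simp
    · congr 1 with ξ
      rw [fourier_sub hf hg]
      rfl
  · intro r hr
    rw [lintegral_rpow_mul_one_sub_exp_neg_mul (by positivity) (by linarith) (by linarith)]
    rw [← rpow_natCast, ← rpow_mul hr.le]
    congr 3
    · congr 1; ring
    · push_cast; ring
  · intro t ht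
    have hI := hfg'.mul_prod hfg'
    have h0 : ∫ p : EuclideanSpace ℝ (Fin n) × EuclideanSpace ℝ (Fin n),
        (f - g) p.1 * (f - g) p.2 ∂(volume.prod volume) = 0 := by
      rw [integral_prod_mul]
      simp only [Pi.sub_apply]
      rw [integral_sub hf hg, hfg, sub_self, zero_mul]
    have hE : Integrable (fun p : EuclideanSpace ℝ (Fin n) × EuclideanSpace ℝ (Fin n) =>
        exp (-(‖p.1 - p.2‖ ^ 2 * t)) * ((f - g) p.1 * (f - g) p.2)) (volume.prod volume) := by
      refine hI.mono ((Continuous.aestronglyMeasurable (by fun_prop)).mul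
        hI.aestronglyMeasurable) (Filter.Eventually.of_forall fun p => ?_)
      rw [norm_mul]
      refine mul_le_of_le_one_left (norm_nonneg _) ?_
      rw [norm_of_nonneg (exp_pos _).le]
      exact exp_le_one_iff.2 (neg_nonpos.2 (by positivity))
    simp only [mul_assoc, sub_mul, one_mul]
    rw [integral_const_mul, integral_sub hI hE, h0, neg_div]
    ring

/-! ### The interpolation inequality -/

theorem cConst_pos (n : ℕ) {α : ℝ} (hα0 : 0 < α) (hα2 : α < 2) : 0 < cConst n α := by
  have h1 : 0 < Gamma ((2 - α) / 2) := Gamma_pos_of_pos (by linarith)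
  have h2 : 0 < Gamma (((n : ℝ) + α) / 2) := Gamma_pos_of_pos (by positivity)
  rw [cConst]
  positivity

theorem dConst_pos (hn : 2 ≤ n) {α : ℝ} (hα0 : 0 < α) (hα2 : α < 2) : 0 < dConst n α := by
  have hn' : (2 : ℝ) ≤ n := by exact_mod_cast hn
  have h1 : 0 < Gamma ((2 - α) / 2) := Gamma_pos_of_pos (by linarith)
  have h2 : 0 < Gamma (((n : ℝ) - 2 + α) / 2) := Gamma_pos_of_pos (by linarith)
  rw [dConst]
  positivity

theorem AConst_pos (hn : n ≠ 0) {α : ℝ} (hα0 : 0 < α) (hα2 : α < 2) : 0 < AConst n α := by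
  have h1 := cConst_pos n hα0 hα2
  have h2 : 0 < Gamma ((n : ℝ) / 2) := Gamma_pos_of_pos (by positivity)
  rw [AConst]
  positivity

theorem BConst_pos (hn : 2 ≤ n) {α : ℝ} (hα0 : 0 < α) (hα2 : α < 2) : 0 < BConst n α :=
  div_pos (cConst_pos n hα0 hα2) (dConst_pos hn hα0 hα2)

theorem DConst_pos (hn : 2 ≤ n) {α : ℝ} (hα0 : 0 < α) (hα2 : α < 2) : 0 < DConst n α := by
  have h1 := AConst_pos (n := n) (by omega) hα0 hα2
  have h2 := BConst_pos hn hα0 hα2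
  have h3 : 0 < 2 - α := by linarith
  rw [DConst]
  positivity

theorem lintegral_ball_norm_rpow (hn : n ≠ 0) {s R : ℝ} (hs : 0 < s) (hR : 0 < R) :
    ∫⁻ ξ in Metric.ball (0 : EuclideanSpace ℝ (Fin n)) R, ENNReal.ofReal (‖ξ‖ ^ (s - n)) =
      ENNReal.ofReal (2 * π ^ ((n : ℝ) / 2) / Gamma ((n : ℝ) / 2) * (R ^ s / s)) := by
  have : NeZero n := ⟨hn⟩
  set φ : ℝ → ℝ := (Iio R).indicator fun y => y ^ (s - n) with hφ
  have hball : ∀ ξ : EuclideanSpace ℝ (Fin n),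
      (Metric.ball (0 : EuclideanSpace ℝ (Fin n)) R).indicator (fun ξ => ‖ξ‖ ^ (s - n)) ξ =
        φ ‖ξ‖ := by
    intro ξ
    simp [hφ, indicator]
  have hφ' : ∀ y ∈ Ioi (0 : ℝ), y ^ (n - 1) • φ y = (Iio R).indicator (fun y => y ^ (s - 1)) y := by
    intro y hy
    have hy : 0 < y := hy
    by_cases hyR : y < R
    · simp only [hφ, indicator, mem_Iio, hyR, if_true, smul_eq_mul]
      rw [← rpow_natCast, ← rpow_add hy, Nat.cast_sub (Nat.one_le_iff_ne_zero.2 hn)]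
      congr 1
      push_cast
      ring
    · simp [hφ, indicator, hyR]
  have hII : IntervalIntegrable (fun y : ℝ => y ^ (s - 1)) volume 0 R :=
    intervalIntegral.intervalIntegrable_rpow' (by linarith)
  have hIoo : IntegrableOn (fun y : ℝ => y ^ (s - 1)) (Ioo 0 R) :=
    (intervalIntegrable_iff_integrableOn_Ioo_of_le hR.le).1 hII
  have hint : Integrable fun ξ : EuclideanSpace ℝ (Fin n) => φ ‖ξ‖ := by
    rw [integrable_fun_norm_addHaar, finrank_euclideanSpace_fin,
      integrableOn_congr_fun hφ' measurableSet_Ioi, IntegrableOn,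
      integrable_indicator_iff measurableSet_Iio, IntegrableOn,
      Measure.restrict_restrict measurableSet_Iio, Iio_inter_Ioi]
    exact hIoo
  have hvol : (volume : Measure (EuclideanSpace ℝ (Fin n))).real (Metric.ball 0 1) =
      π ^ ((n : ℝ) / 2) / Gamma ((n : ℝ) / 2 + 1) := by
    have hΓ : 0 < Gamma ((n : ℝ) / 2 + 1) := Gamma_pos_of_pos (by positivity)
    rw [measureReal_def, EuclideanSpace.volume_ball, Fintype.card_fin, ENNReal.ofReal_one,
      one_pow, one_mul, ENNReal.toReal_ofReal (by positivity), sqrt_eq_rpow, ← rpow_natCast,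
      ← rpow_mul pi_pos.le]
    congr 2
    ring
  have hval : ∫ ξ : EuclideanSpace ℝ (Fin n), φ ‖ξ‖ =
      2 * π ^ ((n : ℝ) / 2) / Gamma ((n : ℝ) / 2) * (R ^ s / s) := by
    have hΓ : 0 < Gamma ((n : ℝ) / 2) := Gamma_pos_of_pos (by positivity)
    rw [integral_fun_norm_addHaar, finrank_euclideanSpace_fin,
      setIntegral_congr_fun measurableSet_Ioi hφ', integral_indicator measurableSet_Iio,
      Measure.restrict_restrict measurableSet_Iio, Iio_inter_Ioi, ← integral_Ioc_eq_integral_Ioo,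
      ← intervalIntegral.integral_of_le hR.le, integral_rpow (Or.inl (by linarith)), hvol,
      Gamma_add_one (by positivity), sub_add_cancel, zero_rpow hs.ne', sub_zero, smul_eq_mul,
      nsmul_eq_mul]
    field_simp
  rw [← lintegral_indicator Metric.isOpen_ball.measurableSet, ← hval,
    ofReal_integral_eq_lintegral_ofReal hint]
  · refine lintegral_congr fun ξ => ?_
    rw [← hball]
    by_cases hξ : ξ ∈ Metric.ball (0 : EuclideanSpace ℝ (Fin n)) R <;> simp [indicator, hξ]
  · refine Filter.Eventually.of_forall fun ξ => ?_
    simp only [← hball]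
    exact indicator_nonneg (fun _ _ => by positivity) ξ

theorem norm_fourier_sub_le {f g : EuclideanSpace ℝ (Fin n) → ℝ} (hd : dOne f g ≠ ∞)
    {ξ : EuclideanSpace ℝ (Fin n)} (hξ : ξ ≠ 0) :
    ‖fourier f ξ - fourier g ξ‖ ≤ (dOne f g).toReal * ‖ξ‖ := by
  have h : ENNReal.ofReal (‖fourier f ξ - fourier g ξ‖ / ‖ξ‖) ≤ dOne f g :=
    le_iSup₂ (f := fun (ξ : EuclideanSpace ℝ (Fin n)) (_ : ξ ≠ 0) =>
      ENNReal.ofReal (‖fourier f ξ - fourier g ξ‖ / ‖ξ‖)) ξ hξ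
  have := (ENNReal.ofReal_le_iff_le_toReal hd).1 h
  rwa [div_le_iff₀ (norm_pos_iff.2 hξ)] at this

/-- The energy is split at the frequency radius `R`: low frequencies are controlled by `d₁`, high
frequencies by the energy of negative order. -/
theorem energyFourier_le_add (hn : 2 ≤ n) {α : ℝ} (hα0 : 0 < α) (hα2 : α < 2)
    {f g : EuclideanSpace ℝ (Fin n) → ℝ} (hd : dOne f g ≠ ∞) {R : ℝ} (hR : 0 < R) :
    energyFourier α f g ≤
      ENNReal.ofReal (AConst n α * (dOne f g).toReal ^ 2 * (R ^ (2 - α) / (2 - α))) +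
        ENNReal.ofReal (BConst n α * R ^ (-2 : ℝ)) * negEnergyFourier α f g := by
  have hn' : (2 : ℝ) ≤ n := by exact_mod_cast hn
  have hn0 : n ≠ 0 := by omega
  have hc := cConst_pos n hα0 hα2
  have hdc := dConst_pos hn hα0 hα2
  have hB := BConst_pos hn hα0 hα2
  set δ := (dOne f g).toReal with hδ
  have hδ0 : 0 ≤ δ := ENNReal.toReal_nonneg
  set N : EuclideanSpace ℝ (Fin n) → ℝ := fun ξ => ‖fourier f ξ - fourier g ξ‖ with hN
  have hin : ∫⁻ ξ in Metric.ball 0 R, ENNReal.ofReal (N ξ ^ 2 / ‖ξ‖ ^ ((n : ℝ) + α)) ≤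
      ENNReal.ofReal (δ ^ 2) * ENNReal.ofReal
        (2 * π ^ ((n : ℝ) / 2) / Gamma ((n : ℝ) / 2) * (R ^ (2 - α) / (2 - α))) := by
    rw [← lintegral_ball_norm_rpow hn0 (by linarith) hR,
      ← lintegral_const_mul' _ _ ENNReal.ofReal_ne_top]
    refine lintegral_mono fun ξ => ?_
    rw [← ENNReal.ofReal_mul (by positivity)]
    refine ENNReal.ofReal_le_ofReal ?_
    rcases eq_or_ne ξ 0 with rfl | hξ
    · -- at the origin the quotient is a division by zero, hence `0`
      rw [norm_zero, zero_rpow (by positivity), div_zero]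
      positivity
    · have hξ' : 0 < ‖ξ‖ := norm_pos_iff.2 hξ
      have h2 : N ξ ^ 2 ≤ (δ * ‖ξ‖) ^ 2 :=
        pow_le_pow_left₀ (norm_nonneg _) (norm_fourier_sub_le hd hξ) 2
      rw [div_le_iff₀ (by positivity), mul_assoc, ← rpow_add hξ',
        show 2 - α - n + (n + α) = (2 : ℝ) by ring, rpow_two, ← mul_pow]
      exact h2
  have hout : ∫⁻ ξ in (Metric.ball 0 R)ᶜ, ENNReal.ofReal (N ξ ^ 2 / ‖ξ‖ ^ ((n : ℝ) + α)) ≤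
      ENNReal.ofReal (R ^ (-2 : ℝ)) *
        ∫⁻ ξ, ENNReal.ofReal (N ξ ^ 2 / ‖ξ‖ ^ ((n : ℝ) - 2 + α)) := by
    refine le_trans ?_ (mul_le_mul_right (setLIntegral_le_lintegral (Metric.ball 0 R)ᶜ _) _)
    rw [← lintegral_const_mul' _ _ ENNReal.ofReal_ne_top]
    refine setLIntegral_mono' Metric.isOpen_ball.measurableSet.compl fun ξ hξ => ?_
    have hξR : R ≤ ‖ξ‖ := by simpa using hξ
    have hξ' : 0 < ‖ξ‖ := hR.trans_le hξR
    rw [← ENNReal.ofReal_mul (by positivity)]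
    refine ENNReal.ofReal_le_ofReal ?_
    have h2 : ‖ξ‖ ^ (-2 : ℝ) ≤ R ^ (-2 : ℝ) :=
      rpow_le_rpow_of_nonpos hR hξR (by norm_num)
    calc N ξ ^ 2 / ‖ξ‖ ^ ((n : ℝ) + α)
        = ‖ξ‖ ^ (-2 : ℝ) * (N ξ ^ 2 / ‖ξ‖ ^ ((n : ℝ) - 2 + α)) := by
          rw [show (n : ℝ) + α = 2 + (n - 2 + α) by ring, rpow_add hξ', rpow_neg hξ'.le]
          field_simp
      _ ≤ R ^ (-2 : ℝ) * (N ξ ^ 2 / ‖ξ‖ ^ ((n : ℝ) - 2 + α)) := by gcongr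
  rw [energyFourier, ← lintegral_add_compl _ (Metric.isOpen_ball (x := 0) (ε := R)).measurableSet,
    mul_add]
  refine add_le_add ((mul_le_mul_right hin _).trans_eq ?_) ((mul_le_mul_right hout _).trans_eq ?_)
  · rw [← ENNReal.ofReal_mul (by positivity), ← ENNReal.ofReal_mul hc.le, AConst]
    congr 1
    ring
  · rw [negEnergyFourier, ← mul_assoc, ← mul_assoc, ← ENNReal.ofReal_mul hc.le,
      ← ENNReal.ofReal_mul (by positivity), BConst]
    congr 2
    field_simp

/-- The value at its minimiser of `R ↦ a * R ^ (2 - α) / (2 - α) + b * R ^ (-2)`. -/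
theorem value_at_optimal_radius {a b α : ℝ} (ha : 0 < a) (hb : 0 < b) (hα2 : α < 2) :
    a * (((2 * b / a) ^ (1 / (4 - α))) ^ (2 - α) / (2 - α)) +
        b * ((2 * b / a) ^ (1 / (4 - α))) ^ (-2 : ℝ) =
      a ^ (2 / (4 - α)) * b ^ ((2 - α) / (4 - α)) *
        (2 ^ ((2 - α) / (4 - α)) / (2 - α) + (1 / 2) ^ (2 / (4 - α))) := by
  have h4 : 4 - α ≠ 0 := by linarith
  have h2 : 2 - α ≠ 0 := by linarith
  set q := (2 - α) / (4 - α) with hq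
  set p := 2 / (4 - α) with hp
  have hpq : p + q = 1 := by rw [hp, hq]; field_simp; ring
  have e1 : ((2 * b / a) ^ (1 / (4 - α))) ^ (2 - α) = 2 ^ q * b ^ q / a ^ q := by
    rw [← rpow_mul (by positivity), div_rpow (by positivity) ha.le,
      mul_rpow (by norm_num) hb.le, one_div_mul_eq_div]
  have e2 : ((2 * b / a) ^ (1 / (4 - α))) ^ (-2 : ℝ) = (1 / 2) ^ p * a ^ p / b ^ p := by
    rw [← rpow_mul (by positivity), show 1 / (4 - α) * -2 = -p by rw [hp]; ring,
      rpow_neg (by positivity), div_rpow (by positivity) ha.le, mul_rpow (by norm_num) hb.le,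
      div_rpow zero_le_one zero_le_two, one_rpow]
    field_simp
  have ea : a = a ^ p * a ^ q := by rw [← rpow_add ha, hpq, rpow_one]
  have eb : b = b ^ p * b ^ q := by rw [← rpow_add hb, hpq, rpow_one]
  rw [e1, e2]
  have hap := (rpow_pos_of_pos ha p).ne'
  have haq := (rpow_pos_of_pos ha q).ne'
  have hbp := (rpow_pos_of_pos hb p).ne'
  have hbq := (rpow_pos_of_pos hb q).ne'
  have t1 : a * (2 ^ q * b ^ q / a ^ q / (2 - α)) = a ^ p * b ^ q * (2 ^ q / (2 - α)) := by
    nth_rewrite 1 [ea]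
    field_simp
  have t2 : b * ((1 / 2) ^ p * a ^ p / b ^ p) = a ^ p * b ^ q * (1 / 2) ^ p := by
    nth_rewrite 1 [eb]
    field_simp
  rw [t1, t2]
  ring

theorem energyFourier_eq_zero {α : ℝ} (hα0 : 0 < α) {f g : EuclideanSpace ℝ (Fin n) → ℝ}
    (h : ∀ᵐ ξ, ξ ≠ 0 → ‖fourier f ξ - fourier g ξ‖ = 0) : energyFourier α f g = 0 := by
  have h0 : ∫⁻ ξ : EuclideanSpace ℝ (Fin n),
      ENNReal.ofReal (‖fourier f ξ - fourier g ξ‖ ^ 2 / ‖ξ‖ ^ ((n : ℝ) + α)) = 0 := by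
    rw [← lintegral_zero (α := EuclideanSpace ℝ (Fin n)) (μ := volume)]
    refine lintegral_congr_ae ?_
    filter_upwards [h] with ξ hξ
    rcases eq_or_ne ξ 0 with rfl | hne
    · rw [norm_zero, zero_rpow (by positivity), div_zero, ENNReal.ofReal_zero]
    · rw [hξ hne, zero_pow two_ne_zero, zero_div, ENNReal.ofReal_zero]
  rw [energyFourier, h0, mul_zero]

theorem energyFourier_eq_zero_of_negEnergyFourier_eq_zero (hn : 2 ≤ n) {α : ℝ} (hα0 : 0 < α)
    (hα2 : α < 2) {f g : EuclideanSpace ℝ (Fin n) → ℝ} (hf : Integrable f) (hg : Integrable g)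
    (h : negEnergyFourier α f g = 0) : energyFourier α f g = 0 := by
  have h1 : ENNReal.ofReal (dConst n α) ≠ 0 := by
    simpa using dConst_pos hn hα0 hα2
  have hfm := (continuous_fourier hf).measurable
  have hgm := (continuous_fourier hg).measurable
  rw [negEnergyFourier, mul_eq_zero, or_iff_right h1, lintegral_eq_zero_iff (by fun_prop)] at h
  refine energyFourier_eq_zero hα0 ?_
  filter_upwards [h] with ξ hξ hne
  have hpos : 0 < ‖ξ‖ ^ ((n : ℝ) - 2 + α) := rpow_pos_of_pos (norm_pos_iff.2 hne) _
  have h2 : ‖fourier f ξ - fourier g ξ‖ ^ 2 / ‖ξ‖ ^ ((n : ℝ) - 2 + α) ≤ 0 :=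
    ENNReal.ofReal_eq_zero.1 hξ
  rw [div_le_iff₀ hpos, zero_mul] at h2
  exact pow_eq_zero_iff two_ne_zero |>.1 (le_antisymm h2 (by positivity))

theorem energyFourier_le (hn : 2 ≤ n) {α : ℝ} (hα0 : 0 < α) (hα2 : α < 2)
    {f g : EuclideanSpace ℝ (Fin n) → ℝ} (hf : Integrable f) (hg : Integrable g) :
    energyFourier α f g ≤ ENNReal.ofReal (DConst n α) * dOne f g ^ (4 / (4 - α)) *
      negEnergyFourier α f g ^ ((2 - α) / (4 - α)) := by
  have h4 : 0 < 4 - α := by linarith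
  have hp : 0 < 4 / (4 - α) := by positivity
  have hq : 0 < (2 - α) / (4 - α) := div_pos (by linarith) h4
  have hA := AConst_pos (n := n) (by omega) hα0 hα2
  have hB := BConst_pos hn hα0 hα2
  have hD : ENNReal.ofReal (DConst n α) ≠ 0 := by simpa using DConst_pos hn hα0 hα2
  by_cases hE0 : negEnergyFourier α f g = 0
  · -- covers the product `∞ * 0` on the right: the left side vanishes too
    rw [energyFourier_eq_zero_of_negEnergyFourier_eq_zero hn hα0 hα2 hf hg hE0]
    exact zero_le
  by_cases hd0 : dOne f g = 0
  · rw [energyFourier_eq_zero hα0 (Filter.Eventually.of_forall fun ξ hξ => ?_)]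
    · exact zero_le
    · have := norm_fourier_sub_le (f := f) (g := g) (by simp [hd0]) hξ
      rw [hd0, ENNReal.toReal_zero, zero_mul] at this
      exact le_antisymm this (norm_nonneg _)
  have hdp : dOne f g ^ (4 / (4 - α)) ≠ 0 := by simp [hd0, hp.not_gt]
  have hEq : negEnergyFourier α f g ^ ((2 - α) / (4 - α)) ≠ 0 := by simp [hE0, hq.not_gt]
  by_cases hd : dOne f g = ∞
  · rw [hd, ENNReal.top_rpow_of_pos hp, ENNReal.mul_top hD, ENNReal.top_mul hEq]
    exact le_top
  by_cases hE : negEnergyFourier α f g = ∞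
  · rw [hE, ENNReal.top_rpow_of_pos hq, ENNReal.mul_top (mul_ne_zero hD hdp)]
    exact le_top
  set δ := (dOne f g).toReal with hδ
  set e := (negEnergyFourier α f g).toReal with he
  have hδ0 : 0 < δ := ENNReal.toReal_pos hd0 hd
  have he0 : 0 < e := ENNReal.toReal_pos hE0 hE
  have hδ' : dOne f g = ENNReal.ofReal δ := (ENNReal.ofReal_toReal hd).symm
  have he' : negEnergyFourier α f g = ENNReal.ofReal e := (ENNReal.ofReal_toReal hE).symm
  have ha : 0 < AConst n α * δ ^ 2 := by positivity
  have hb : 0 < BConst n α * e := by positivity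
  -- the radius that minimises the sum of the two bounds
  set R := (2 * (BConst n α * e) / (AConst n α * δ ^ 2)) ^ (1 / (4 - α)) with hR
  have hR0 : 0 < R := by positivity
  have h2 : 0 < 2 - α := by linarith
  refine (energyFourier_le_add hn hα0 hα2 hd hR0).trans_eq ?_
  rw [← hδ, he', hδ', ENNReal.ofReal_rpow_of_pos hδ0, ENNReal.ofReal_rpow_of_pos he0,
    ← ENNReal.ofReal_mul (by positivity), ← ENNReal.ofReal_add (by positivity) (by positivity),
    ← ENNReal.ofReal_mul (DConst_pos hn hα0 hα2).le,
    ← ENNReal.ofReal_mul (mul_nonneg (DConst_pos hn hα0 hα2).le (by positivity)),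
    mul_right_comm (BConst n α), value_at_optimal_radius ha hb hα2]
  congr 1
  rw [DConst, mul_rpow hA.le (by positivity), mul_rpow hB.le he0.le, ← rpow_natCast δ 2,
    ← rpow_mul hδ0.le, show ((2 : ℕ) : ℝ) * (2 / (4 - α)) = 4 / (4 - α) by push_cast; ring]
  ring

end EnergyDistance

theorem mainTheorem2 (n : ℕ) (hn : 2 ≤ n) (α : ℝ) (hα0 : 0 < α) (hα2 : α < 2)
    (f g : EuclideanSpace ℝ (Fin n) → ℝ)
    (hf : EnergyDistance.IsProbDensity f) (hg : EnergyDistance.IsProbDensity g) :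
    -- the inequality in `[0,∞]`, for all pairs of densities
    EnergyDistance.energyFourier α f g ≤
        ENNReal.ofReal (EnergyDistance.DConst n α) *
          EnergyDistance.dOne f g ^ (4 / (4 - α)) *
          EnergyDistance.negEnergyFourier α f g ^ ((2 - α) / (4 - α)) ∧
    -- the Fourier forms agree with the double integrals whenever the latter make sense
    (EnergyDistance.Converges α f g →
      0 ≤ EnergyDistance.energy α f g ∧
      ENNReal.ofReal (EnergyDistance.energy α f g) = EnergyDistance.energyFourier α f g) ∧
    (EnergyDistance.Converges (-(2 - α)) f g →
      0 ≤ EnergyDistance.negEnergy α f g ∧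
      ENNReal.ofReal (EnergyDistance.negEnergy α f g) =
        EnergyDistance.negEnergyFourier α f g) ∧
    -- the inequality for the double integrals
    (EnergyDistance.Converges α f g → EnergyDistance.Converges (-(2 - α)) f g →
      ENNReal.ofReal (EnergyDistance.energy α f g) ≤
        ENNReal.ofReal (EnergyDistance.DConst n α) *
          EnergyDistance.dOne f g ^ (4 / (4 - α)) *
          ENNReal.ofReal (EnergyDistance.negEnergy α f g) ^ ((2 - α) / (4 - α))) := by
  have hle := EnergyDistance.energyFourier_le hn hα0 hα2 hf.integrable hg.integrable
  have hE := EnergyDistance.energy_eq_energyFourier (by omega) hα0 hα2 hf.integrable hg.integrable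
    (hf.integral_eq_one.trans hg.integral_eq_one.symm)
  have hN := EnergyDistance.negEnergy_eq_negEnergyFourier hn hα0 hα2 hf.integrable hg.integrable
  refine ⟨hle, hE, hN, fun h1 h2 => ?_⟩
  rw [(hE h1).2, (hN h2).2]
  exact hle
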